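/- Let $\mathbb{B}$ be an infinite set of visible actions, $\tau\notin\mathbb B$ the internal action and $\mathbb B_\tau=\mathbb B\cup\{\tau\}$. *Process algebra.* PAFAS$_s$ terms are built from ${\sf nil}$, variables, lazy and urgent action prefixes $\alpha.P$ and $\underline\alpha.P$ ($P$ without urgent actions), read-set prefixes $\{\mu_1,\dots,\mu_n\}\triangleright Q$ (a finite set of lazy or urgent actions, never containing both $\alpha$ and $\underline\alpha$), $Q_1+Q_2$, $Q_1\|_A Q_2$ ($A\subseteq\mathbb B$), relabelling $Q[\Phi]$ ($\Phi:\mathbb B_\tau\to\mathbb B_\tau$ with $\Phi(\tau)=\tau$ and $\emptyset\ne\Phi^{-1}(\alpha)\neq\{\alpha\}$ for only finitely many $\alpha$) and guarded recursion ${\sf rec}\,x.Q$; a process is a closed term. Action transitions $\xrightarrow{\alpha}$ are the usual ones, where $\{\mu_1,\dots,\mu_n\}\triangleright Q$ can also perform each $\alpha$ with $\alpha$ or $\underline\alpha$ among the $\mu_i$ without changing, and loses its read set when $Q$ performs an action. Partial time steps $\xrightarrow{X}_r$ ($X\subseteq\mathbb B$) make all offered lazy actions urgent. A process ${\sf nil}$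 or $\alpha.P$ permits every $X$; $\underline\alpha.P$ permits $X$ if $\alpha\notin X\cup\{\tau\}$; a read-set prefix requires that none of its urgent actions is in $X\cup\{\tau\}$ and that its body permits $X$; both summands of a choice must permit $X$; $Q_1\|_AQ_2$ permits $X$ if each $Q_i$ permits some $X_i$ with $X\subseteq(A\cap(X_1\cup X_2))\cup((X_1\cap X_2)\setminus A)$; $Q[\Phi]$ permits $X$ if $Q$ permits $\Phi^{-1}(X\cup\{\tau\})\setminus\{\tau\}$; and a recursion behaves as its unfolding. A term is *read-guarded* if each of its read-set prefixes is in the scope of an action prefix. A term is *proper* if each subterm $Q_1+Q_2$ is read-guarded; $Q_1$ is read-guarded for each subterm $\{\mu_1,\dots,\mu_n\}\triangleright Q_1$; and for each subterm ${\sf rec}\,x.Q_1$, either $Q_1$ is read-guarded, or the free occurrences of $x$ in $Q_1$ are guarded by an action prefix within every subterm of $Q_1$ of the form $R_1+R_2$, $\{\mu_1,\dots,\mu_n\}\triangleright R$ (within $R$) or ${\sf rec}\,y.R$ (within $R$). *Nets.* A net with read arcs $N$ has finite sets $S$ of places and $T$ of transitions, presets $\bullet t$, postsets $t\bullet$ and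 read sets $\hat t$ of places for $t\in T$, an initial marking $M_N$ and a labelling $l:T\to\mathbb B_\tau$. Transition $t$ is enabled under $M$ if every place in $\bullet t\cup\hat t$ is marked; firing it removes a token from each place of $\bullet t$ and adds one to each place of $t\bullet$. $N$ is safe if no reachable marking puts more than one token on a place. A timed state is a pair $(M,U)$ of a marking and a set $U\subseteq T$ of urgent transitions. If $t$ fires under $M$ yielding $M'$, then $(M,U)\xrightarrow{l(t)}(M',U')$ with $U'=U\setminus\{t'\mid \bullet t\cap(\bullet t'\cup\hat t')\ne\emptyset\}$. If $X\subseteq\mathbb B$ and no $t\in U$ has $l(t)\in X\cup\{\tau\}$, then $(M,U)\xrightarrow{X}_r(M,\{t\mid t\text{ is enabled under }M\})$. **Theorem.** Let $N$ be a safe Petri net with read arcs, and let $U$ be any set of transitions enabled under $M_N$ (in particular $U=\emptyset$, or all enabled transitions). Then there is a proper PAFAS$_s$ process $Q$ such that $(M_N,U)$ and $Q$ are timed bisimilar, i.e. related by a relation whose two sides can match each other's $\xrightarrow{\alpha}$ and $\xrightarrow{X}_r$ moves for all $\alpha\in\mathbb B_\tau$ and $X\subseteq\mathbb B$. Moreover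 $Q$ can be chosen as follows. Name the transitions by distinct visible actions. For each place $s$ define $P_0\Leftarrow\sum_{t''}t''.P_1$ (empty place) and $P_1\Leftarrow\{\text{readers of }s\}\triangleright\big(\sum_{t}t.P_0+\sum_{t'}t'.P_1\big)$ (marked place), without read prefix if there are no readers. Here $t''$ ranges over the transitions with $s\in t''\bullet\setminus(\bullet t''\cup\hat t'')$, $t$ over those with $s\in\bullet t\setminus t\bullet$, $t'$ over those with $s\in\bullet t'\cap t'\bullet$, and the readers are the transitions $r$ with $s\in\hat r\setminus\bullet r$. Take for each place the process that corresponds to $M_N(s)$, with its initially offered actions from $U$ made urgent; compose these processes in parallel, synchronising each time over all common transitions (and add one process $\{t_1,\dots,t_k\}\triangleright{\sf nil}$ for the transitions connected to no place, if there are any); finally relabel each transition name $t$ to $l(t)$. -/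

import Mathlib

/-! ### Actions, relabellings and read sets -/

/-- `some a` is the visible action `a`, and `none` is the internal action `τ`
(on nets: the empty label `λ`). -/
abbrev Act (B : Type*) := Option B

/-- General relabelling functions: `Φ τ = τ`, and only finitely many actions `α` satisfy
`∅ ≠ Φ⁻¹(α) ≠ {α}`. -/
structure Relabelling (B : Type*) where
  toFun : Act B → Act B
  map_tau : toFun none = none
  finite_base : {α : Act B | toFun ⁻¹' {α} ≠ ∅ ∧ toFun ⁻¹' {α} ≠ {α}}.Finite

/-- Finite sets of lazy and urgent actions that do not contain a lazy and an urgent copy of the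
same action. `lazySet` is the set of `α` whose lazy copy belongs to the set, `urgentSet` the set
of `α` whose urgent copy belongs to it. -/
structure ReadSet (B : Type*) where
  lazySet : Set (Act B)
  urgentSet : Set (Act B)
  finite_lazy : lazySet.Finite
  finite_urgent : urgentSet.Finite
  disjoint : Disjoint lazySet urgentSet

/-- The read set in which every action has become urgent. -/
def ReadSet.underline {B : Type*} (R : ReadSet B) : ReadSet B where
  lazySet := ∅
  urgentSet := R.lazySet ∪ R.urgentSet
  finite_lazy := Set.finite_empty
  finite_urgent := R.finite_lazy.union R.finite_urgent
  disjoint := Set.empty_disjoint _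

/-! ### Terms of PAFAS with read-set prefixes -/

/-- Raw terms, with process variables named by natural numbers.
`pre false α P` is `α.P`, `pre true α P` is the urgent prefix `α̲.P`, `read R Q` is `R ▷ Q`,
`par A Q₁ Q₂` is `Q₁ ‖_A Q₂`, `rel Q Φ` is `Q[Φ]` and `recur x Q` is `rec x. Q`. -/
inductive Term (B : Type*) where
  | nil : Term B
  | var (x : ℕ) : Term B
  | pre (urgent : Bool) (α : Act B) (P : Term B) : Term B
  | read (R : ReadSet B) (Q : Term B) : Term B
  | sum (Q₁ Q₂ : Term B) : Term B
  | par (A : Set B) (Q₁ Q₂ : Term B) : Term B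
  | rel (Q : Term B) (Φ : Relabelling B) : Term B
  | recur (x : ℕ) (Q : Term B) : Term B

namespace Term

variable {B : Type*}

/-- `x` occurs free in the term. -/
def FreeIn (x : ℕ) : Term B → Prop
  | nil => False
  | var y => y = x
  | pre _ _ P => FreeIn x P
  | read _ Q => FreeIn x Q
  | sum Q₁ Q₂ => FreeIn x Q₁ ∨ FreeIn x Q₂
  | par _ Q₁ Q₂ => FreeIn x Q₁ ∨ FreeIn x Q₂
  | rel Q _ => FreeIn x Q
  | recur y Q => y ≠ x ∧ FreeIn x Q

def Closed (Q : Term B) : Prop := ∀ x, ¬ FreeIn x Q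

/-- `x` is guarded: every free occurrence of `x` is in the scope of an action prefix. -/
def Guarded (x : ℕ) : Term B → Prop
  | nil => True
  | var y => y ≠ x
  | pre _ _ _ => True
  | read _ Q => Guarded x Q
  | sum Q₁ Q₂ => Guarded x Q₁ ∧ Guarded x Q₂
  | par _ Q₁ Q₂ => Guarded x Q₁ ∧ Guarded x Q₂
  | rel Q _ => Guarded x Q
  | recur y Q => y = x ∨ Guarded x Q

/-- The grammar of initial process terms (no urgent actions), with guarded recursion. -/
def IsInitial : Term B → Prop
  | nil => True
  | var _ => True
  | pre u _ P => u = false ∧ IsInitial P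
  | read R P => R.urgentSet = ∅ ∧ IsInitial P
  | sum P₁ P₂ => IsInitial P₁ ∧ IsInitial P₂
  | par _ P₁ P₂ => IsInitial P₁ ∧ IsInitial P₂
  | rel P _ => IsInitial P
  | recur x P => Guarded x P ∧ IsInitial P

/-- The grammar of general process terms, with guarded recursion: the body of a (lazy or urgent)
action prefix is an initial term. -/
def IsTerm : Term B → Prop
  | nil => True
  | var _ => True
  | pre _ _ P => IsInitial P
  | read _ Q => IsTerm Q
  | sum Q₁ Q₂ => IsTerm Q₁ ∧ IsTerm Q₂
  | par _ Q₁ Q₂ => IsTerm Q₁ ∧ IsTerm Q₂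
  | rel Q _ => IsTerm Q
  | recur x Q => Guarded x Q ∧ IsTerm Q

/-- Processes are the closed general process terms. -/
def IsProc (Q : Term B) : Prop := IsTerm Q ∧ Closed Q

/-- Every read-set prefix is in the scope of an action prefix. -/
def ReadGuarded : Term B → Prop
  | nil => True
  | var _ => True
  | pre _ _ _ => True
  | read _ _ => False
  | sum Q₁ Q₂ => ReadGuarded Q₁ ∧ ReadGuarded Q₂
  | par _ Q₁ Q₂ => ReadGuarded Q₁ ∧ ReadGuarded Q₂
  | rel Q _ => ReadGuarded Q
  | recur _ Q => ReadGuarded Q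

/-- Each subterm `Q₁ + Q₂` is read-guarded, and for each subterm `R ▷ Q₁`, `Q₁` is. -/
def ReadProper : Term B → Prop
  | nil => True
  | var _ => True
  | pre _ _ P => ReadProper P
  | read _ Q => ReadGuarded Q ∧ ReadProper Q
  | sum Q₁ Q₂ => (ReadGuarded Q₁ ∧ ReadGuarded Q₂) ∧ ReadProper Q₁ ∧ ReadProper Q₂
  | par _ Q₁ Q₂ => ReadProper Q₁ ∧ ReadProper Q₂
  | rel Q _ => ReadProper Q
  | recur _ Q => ReadProper Q

/-- Any free `x` is guarded in each subterm `Q₁ + Q₂`, `R ▷ Q₁` and `rec y. Q₁`. -/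
def VarProper (x : ℕ) : Term B → Prop
  | nil => True
  | var _ => True
  | pre _ _ P => VarProper x P
  | read _ Q => Guarded x Q ∧ VarProper x Q
  | sum Q₁ Q₂ => (Guarded x Q₁ ∧ Guarded x Q₂) ∧ VarProper x Q₁ ∧ VarProper x Q₂
  | par _ Q₁ Q₂ => VarProper x Q₁ ∧ VarProper x Q₂
  | rel Q _ => VarProper x Q
  | recur y Q => y = x ∨ (Guarded x Q ∧ VarProper x Q)

/-- In each subterm `rec x. Q₁`, the body `Q₁` is read-guarded or `x`-proper. -/
def RecProper : Term B → Prop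
  | nil => True
  | var _ => True
  | pre _ _ P => RecProper P
  | read _ Q => RecProper Q
  | sum Q₁ Q₂ => RecProper Q₁ ∧ RecProper Q₂
  | par _ Q₁ Q₂ => RecProper Q₁ ∧ RecProper Q₂
  | rel Q _ => RecProper Q
  | recur x Q => (ReadGuarded Q ∨ VarProper x Q) ∧ RecProper Q

def Proper (Q : Term B) : Prop := ReadProper Q ∧ RecProper Q

/-- Substitution of `R` for the free occurrences of `x`. Starting from a closed term, the rules
below only ever substitute closed terms, so that no variable can be captured. -/
def subst (x : ℕ) (R : Term B) : Term B → Term B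
  | nil => nil
  | var y => if y = x then R else var y
  | pre u α P => pre u α (subst x R P)
  | read S Q => read S (subst x R Q)
  | sum Q₁ Q₂ => sum (subst x R Q₁) (subst x R Q₂)
  | par A Q₁ Q₂ => par A (subst x R Q₁) (subst x R Q₂)
  | rel Q Φ => rel (subst x R Q) Φ
  | recur y Q => if y = x then recur y Q else recur y (subst x R Q)

/-! ### Operational semantics -/

/-- Action transitions `Q —α→ Q'`. -/
inductive Step : Term B → Act B → Term B → Prop
  | pre {u α P} : Step (pre u α P) α P
  | read_self {R α Q} (h : α ∈ R.lazySet ∪ R.urgentSet) : Step (read R Q) α (read R Q)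
  | read_body {R α Q Q'} (h : Step Q α Q') : Step (read R Q) α Q'
  | sum_left {Q₁ Q₂ α Q'} (h : Step Q₁ α Q') : Step (sum Q₁ Q₂) α Q'
  | sum_right {Q₁ Q₂ α Q'} (h : Step Q₂ α Q') : Step (sum Q₁ Q₂) α Q'
  | par_left {A Q₁ Q₂ α Q₁'} (hα : α ∉ some '' A) (h : Step Q₁ α Q₁') :
      Step (par A Q₁ Q₂) α (par A Q₁' Q₂)
  | par_right {A Q₁ Q₂ α Q₂'} (hα : α ∉ some '' A) (h : Step Q₂ α Q₂') :
      Step (par A Q₁ Q₂) α (par A Q₁ Q₂')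
  | par_sync {A Q₁ Q₂ α Q₁' Q₂'} (hα : α ∈ some '' A) (h₁ : Step Q₁ α Q₁')
      (h₂ : Step Q₂ α Q₂') : Step (par A Q₁ Q₂) α (par A Q₁' Q₂')
  | rel {Q Φ α Q'} (h : Step Q α Q') : Step (rel Q Φ) (Φ.toFun α) (rel Q' Φ)
  | recur {x Q α Q'} (h : Step (subst x (recur x Q) Q) α Q') : Step (recur x Q) α Q'

/-- Refusal (partial time-step) transitions `Q —X→ᵣ Q'`. -/
inductive TimeStep : Term B → Set B → Term B → Prop
  | nil {X} : TimeStep nil X nil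
  | pre_lazy {X α P} : TimeStep (pre false α P) X (pre true α P)
  | pre_urgent {X α P} (h : α ∉ some '' X ∪ {none}) :
      TimeStep (pre true α P) X (pre true α P)
  | read {X R Q Q'} (h : TimeStep Q X Q') (hR : R.urgentSet ∩ (some '' X ∪ {none}) = ∅) :
      TimeStep (read R Q) X (read R.underline Q')
  | sum {X Q₁ Q₂ Q₁' Q₂'} (h₁ : TimeStep Q₁ X Q₁') (h₂ : TimeStep Q₂ X Q₂') :
      TimeStep (sum Q₁ Q₂) X (sum Q₁' Q₂')
  | par {X X₁ X₂ A Q₁ Q₂ Q₁' Q₂'} (h₁ : TimeStep Q₁ X₁ Q₁') (h₂ : TimeStep Q₂ X₂ Q₂')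
      (hX : X ⊆ (A ∩ (X₁ ∪ X₂)) ∪ ((X₁ ∩ X₂) \ A)) :
      TimeStep (par A Q₁ Q₂) X (par A Q₁' Q₂')
  | rel {X Q Φ Q'} (h : TimeStep Q {a : B | Φ.toFun (some a) ∈ some '' X ∪ {none}} Q') :
      TimeStep (rel Q Φ) X (rel Q' Φ)
  | recur {X x Q Q'} (h : TimeStep (subst x (recur x Q) Q) X Q') : TimeStep (recur x Q) X Q'

end Term

/-! ### Timed bisimilarity -/

/-- Transition systems with action transitions and refusal (time-step) transitions. -/
structure TimedLTS (B : Type*) where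
  State : Type*
  act : State → Act B → State → Prop
  time : State → Set B → State → Prop

/-- `R` is a timed bisimulation between two systems. -/
def IsTimedBisimulation {B : Type*} (L₁ L₂ : TimedLTS B)
    (R : L₁.State → L₂.State → Prop) : Prop :=
  ∀ p q, R p q →
    (∀ α p', L₁.act p α p' → ∃ q', L₂.act q α q' ∧ R p' q') ∧
    (∀ X p', L₁.time p X p' → ∃ q', L₂.time q X q' ∧ R p' q') ∧
    (∀ α q', L₂.act q α q' → ∃ p', L₁.act p α p' ∧ R p' q') ∧
    (∀ X q', L₂.time q X q' → ∃ p', L₁.time p X p' ∧ R p' q')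

def TimedBisimilar {B : Type*} (L₁ L₂ : TimedLTS B) (p : L₁.State) (q : L₂.State) : Prop :=
  ∃ R, IsTimedBisimulation L₁ L₂ R ∧ R p q

/-- The transition system of the process algebra. -/
def Term.lts (B : Type*) : TimedLTS B where
  State := Term B
  act := Term.Step
  time := Term.TimeStep

/-! ### Petri nets with read arcs -/

/-- Nets with places `S`, transitions `T`, ordinary arcs (given by the presets `•t` and postsets
`t•`), read arcs (given by the read sets `t̂`), an initial marking and a labelling. -/
structure ReadNet (B S T : Type*) where
  pre : T → Set S
  post : T → Set S
  rd : T → Set S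
  init : S → ℕ
  label : T → Act B

/-- Instantaneous descriptions: a marking and the set of urgent transitions. -/
structure ReadNet.ID (S T : Type*) where
  marking : S → ℕ
  urgent : Set T

namespace ReadNet

variable {B S T : Type*}

/-- `M[t⟩`: every place in the preset or the read set of `t` carries a token. -/
def Enabled (N : ReadNet B S T) (M : S → ℕ) (t : T) : Prop :=
  ∀ s ∈ N.pre t ∪ N.rd t, 1 ≤ M s

/-- `M[t⟩M'`. -/
def Fires (N : ReadNet B S T) (M : S → ℕ) (t : T) (M' : S → ℕ) : Prop :=
  N.Enabled M t ∧
    ∀ s, M' s = M s - (N.pre t).indicator 1 s + (N.post t).indicator 1 s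

def Reachable (N : ReadNet B S T) (M : S → ℕ) : Prop :=
  Relation.ReflTransGen (fun M₁ M₂ => ∃ t, N.Fires M₁ t M₂) N.init M

def Safe (N : ReadNet B S T) : Prop :=
  ∀ M, N.Reachable M → ∀ s, M s ≤ 1

/-- Firing `t` in an instantaneous description: `t'` stops being urgent if `t` consumes a token
that `t'` needs (consuming or reading it); reading a token has no such effect. -/
def FiresID (N : ReadNet B S T) (D : ID S T) (t : T) (D' : ID S T) : Prop :=
  N.Fires D.marking t D'.marking ∧
    D'.urgent = D.urgent \ {t' | (N.pre t ∩ (N.pre t' ∪ N.rd t')).Nonempty}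

/-- A partial time step with refusal set `X`: no urgent transition is internal or labelled in
`X`, and afterwards exactly the enabled transitions are urgent. -/
def TimeStepID (N : ReadNet B S T) (D : ID S T) (X : Set B) (D' : ID S T) : Prop :=
  (∀ t ∈ D.urgent, N.label t ∉ some '' X ∪ {none}) ∧
    D'.marking = D.marking ∧ D'.urgent = {t | N.Enabled D.marking t}

/-- The timed transition system of a net. -/
def lts (N : ReadNet B S T) : TimedLTS B where
  State := ID S T
  act D α D' := ∃ t, N.label t = α ∧ N.FiresID D t D'
  time := N.TimeStepID

/-! ### The place-wise translation of a net -/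

section Translation

variable [Fintype S] [Fintype T] (N : ReadNet B S T) (nm : T ↪ B) (U : Set T)

/-- The transitions connected to the place `s`. -/
def adjacent (s : S) : Set T := {t | s ∈ N.pre t ∪ N.rd t ∪ N.post t}

/-- The transitions that take the token from `s` (and possibly put it back). -/
def takers (s : S) : Set T := {t | s ∈ N.pre t}

/-- The transitions that only read the token on `s`. -/
def readers (s : S) : Set T := {t | s ∈ N.rd t ∧ s ∉ N.pre t}

/-- The transitions that put a token on `s` without needing one there. -/
def fillers (s : S) : Set T := {t | s ∈ N.post t ∧ s ∉ N.pre t ∪ N.rd t}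

/-- The choice `∑_{t ∈ V} t.(k t)` over prefixed terms, where the prefixes of the transitions
in `U` are urgent (the inactive term `nil` is a neutral summand). -/
noncomputable def choice (V : Set T) (k : T → Term B) : Term B :=
  open Classical in
  (V.toFinset.toList).foldr (fun t Q => .sum (.pre (decide (t ∈ U)) (some (nm t)) (k t)) Q) .nil

/-- The read set of the names of the transitions in `V`, those in `U` being urgent. -/
def readSet (V : Set T) : ReadSet B where
  lazySet := (fun t => some (nm t)) '' (V \ U)
  urgentSet := (fun t => some (nm t)) '' (V ∩ U)
  finite_lazy := Set.toFinite _
  finite_urgent := Set.toFinite _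
  disjoint := by
    rw [Set.disjoint_left]
    rintro _ ⟨t, ht, rfl⟩ ⟨t', ht', h⟩
    have : t' = t := nm.injective (Option.some.inj h)
    exact ht.2 (this ▸ ht'.2)

/-- `Q` with the transitions in `V` as its read set (no prefix if there are none). -/
noncomputable def withReads (V : Set T) (Q : Term B) : Term B :=
  open Classical in if V = ∅ then Q else .read (readSet nm U V) Q

/-- The process of the marked place `s`: `P₁ ⇐ readers ▷ (∑ t.P₀ + ∑ t'.P₁)`, where
`P₀ ⇐ ∑ t''.P₁`; here `t` takes the token from `s`, `t'` also puts it back, and `t''` puts a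
token on `s`. -/
noncomputable def markedProc (s : S) : Term B :=
  open Classical in
  .recur 0 (withReads nm ∅ (N.readers s) (choice nm ∅ (N.takers s) fun t =>
    if s ∈ N.post t then .var 0 else choice nm ∅ (N.fillers s) fun _ => .var 0))

/-- The process of the empty place `s`: `P₀ ⇐ ∑ t''.P₁`. -/
noncomputable def emptyProc (s : S) : Term B :=
  choice nm ∅ (N.fillers s) fun _ => N.markedProc nm s

/-- The process of the place `s` under the initial marking (with the recursion unfolded once),
where the transitions in `U` are urgent. -/
noncomputable def placeProc (s : S) : Term B :=
  open Classical in
  if N.init s = 0 then choice nm U (N.fillers s) fun _ => N.markedProc nm s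
  else withReads nm U (N.readers s) (choice nm U (N.takers s) fun t =>
    if s ∈ N.post t then N.markedProc nm s else N.emptyProc nm s)

/-- The parallel composition of the processes of the places in a list, synchronising each time
over all common transitions. Transitions connected to no place, which are always enabled, are
offered by one further process. -/
noncomputable def compose : List S → Term B
  | [] => withReads nm U {t | ∀ s, t ∉ N.adjacent s} .nil
  | s :: l => .par (nm '' (N.adjacent s ∩ ⋃ s' ∈ l, N.adjacent s')) (N.placeProc nm U s)
      (compose l)

/-- The relabelling that maps the name of each transition to the label of the transition. -/
noncomputable def relabelling : Relabelling B where
  toFun α := open Classical in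
    if h : ∃ t, some (nm t) = α then N.label h.choose else α
  map_tau := by simp
  finite_base := by
    refine ((Set.finite_range N.label).union (Set.finite_range fun t => some (nm t))).subset ?_
    rintro α ⟨h₁, h₂⟩
    by_contra hα
    simp only [Set.mem_union, Set.mem_range, not_or, not_exists] at hα
    apply h₂
    ext β
    simp only [Set.mem_preimage, Set.mem_singleton_iff]
    by_cases hβ : ∃ t, some (nm t) = β
    · rw [dif_pos hβ]
      refine ⟨fun h => absurd h (hα.1 _), ?_⟩
      rintro rfl
      exact absurd hβ (by simpa using hα.2)
    · rw [dif_neg hβ]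

/-- The process of the net: the composed processes of all places, relabelled. -/
noncomputable def toTerm : Term B :=
  .rel (N.compose nm U Finset.univ.toList) (N.relabelling nm)

end Translation

end ReadNet

/-! Each place becomes a sequential component whose state records only whether the place is marked,
and the components synchronise on every common transition name. The process therefore performs the
name of `t` exactly when all components of places adjacent to `t` offer it. A marked place offers
its readers and takers, an empty place its fillers. The fillers of a marked place are blocked by its
component although the net rule does not block them; safeness makes this harmless, since an enabled
transition that puts a token on a place either takes one from it or finds it empty. So enabledness
is a conjunction of local conditions (`Safe.enabled_iff`).

Urgency is local too. A parallel composition can refuse a synchronised action as soon as one partner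
refuses it, so a name blocks a time step only if it is urgent in every adjacent component
(`timeStep_parAll_iff`). Let `W s` be the transitions regarded as urgent at `s`. The invariant
`Corresponds` says that the urgent transitions of the net are the enabled ones that lie in `W s` for
every adjacent `s`; `W₀` plays this role for transitions connected to no place.

When `t` fires, the components that it only reads keep their urgency, and all other adjacent ones
restart lazily, also those where `t` merely puts a token. The net rule cancels urgency only where
`t` consumes. The two rules agree (`Safe.urgent_fires`) because in a safe net no transition adjacent
to a place filled by `t` is enabled both before and after the firing. A time step makes all offers
urgent on both sides, and relabelling turns names into labels, including internal ones. -/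

namespace ReadNet

open Term

variable {B S T : Type*}

/-! ### Transitions of choices and read prefixes -/

section Prefixes

variable [Fintype T] (nm : T ↪ B)

/-- A property of terms that holds of `nil`, of the given prefixes and is preserved by sums holds
of their choice. -/
theorem choice_induction {P : Term B → Prop} {U V : Set T} {k : T → Term B} (nil : P .nil)
    (sum : ∀ t ∈ V, ∀ Q, P Q →
      P (.sum (.pre (open Classical in decide (t ∈ U)) (some (nm t)) (k t)) Q)) :
    P (choice nm U V k) := by
  classical
  unfold choice
  have hl : ∀ t ∈ V.toFinset.toList, t ∈ V := by simp
  generalize V.toFinset.toList = l at hl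
  induction l with
  | nil => exact nil
  | cons t l ih =>
    simp only [List.mem_cons, forall_eq_or_imp] at hl
    exact sum t hl.1 _ (ih hl.2)

theorem subst_choice (x : ℕ) (R : Term B) (U V : Set T) (k : T → Term B) :
    subst x R (choice nm U V k) = choice nm U V fun t => subst x R (k t) := by
  classical
  unfold choice
  generalize V.toFinset.toList = l
  induction l with
  | nil => rfl
  | cons t l ih => simp only [List.foldr_cons, subst, ih]

theorem subst_withReads (x : ℕ) (R : Term B) (U V : Set T) (Q : Term B) :
    subst x R (withReads nm U V Q) = withReads nm U V (subst x R Q) := by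
  unfold withReads
  split_ifs <;> rfl

theorem step_choice_iff {U V : Set T} {k : T → Term B} {α : Act B} {Q : Term B} :
    Step (choice nm U V k) α Q ↔ ∃ t ∈ V, α = some (nm t) ∧ Q = k t := by
  classical
  have hl : ∀ t, t ∈ V ↔ t ∈ V.toFinset.toList := by simp
  simp only [hl]
  unfold choice
  generalize V.toFinset.toList = l
  induction l with
  | nil =>
    simp only [List.foldr_nil, List.not_mem_nil, false_and, exists_false, iff_false]
    rintro ⟨⟩
  | cons t l ih =>
    simp only [List.foldr_cons, List.mem_cons, exists_eq_or_imp, ← ih]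
    constructor
    · rintro (_ | _ | _ | h | h)
      · cases h
        exact .inl ⟨rfl, rfl⟩
      · exact .inr h
    · rintro (⟨rfl, rfl⟩ | h)
      · exact .sum_left .pre
      · exact .sum_right h

/-- Names are visible, so the clause about the internal action never applies. The summands are
listed in an order that depends only on `V`, so the target is literally a `choice` with all prefixes
urgent. -/
theorem timeStep_choice_iff {U V : Set T} {k : T → Term B} {X : Set B} {Q : Term B} :
    TimeStep (choice nm U V k) X Q ↔
      (∀ t ∈ V, t ∈ U → nm t ∉ X) ∧ Q = choice nm Set.univ V k := by
  classical
  have hl : ∀ t, t ∈ V ↔ t ∈ V.toFinset.toList := by simp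
  simp only [hl]
  unfold choice
  generalize V.toFinset.toList = l
  induction l generalizing Q with
  | nil =>
    simp only [List.foldr_nil, List.not_mem_nil, false_imp_iff, implies_true, true_and]
    constructor
    · rintro ⟨⟩
      rfl
    · rintro rfl
      exact .nil
  | cons t l ih =>
    simp only [List.foldr_cons, List.mem_cons, forall_eq_or_imp]
    constructor
    · intro h
      cases h with
      | sum h₁ h₂ =>
        obtain ⟨hU, rfl⟩ := ih.1 h₂
        by_cases ht : t ∈ U
        · simp only [ht, decide_true] at h₁
          cases h₁ with
          | pre_urgent h => exact ⟨⟨fun _ => by simpa using h, hU⟩, by simp⟩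
        · simp only [ht, decide_false] at h₁
          cases h₁
          exact ⟨⟨fun h => absurd h ht, hU⟩, by simp⟩
    · rintro ⟨⟨h₁, h₂⟩, rfl⟩
      refine .sum ?_ (ih.2 ⟨h₂, rfl⟩)
      by_cases ht : t ∈ U
      · simp only [ht, Set.mem_univ, decide_true]
        exact .pre_urgent (by simpa using h₁ ht)
      · simp only [ht, Set.mem_univ, decide_true, decide_false]
        exact .pre_lazy

theorem step_withReads_iff {U V : Set T} {P : Term B} {α : Act B} {Q : Term B} :
    Step (withReads nm U V P) α Q ↔
      (∃ t ∈ V, α = some (nm t) ∧ Q = withReads nm U V P) ∨ Step P α Q := by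
  unfold withReads
  split_ifs with hV
  · simp [hV]
  · constructor
    · intro h
      cases h with
      | read_self h =>
        refine .inl ?_
        rcases h with ⟨t, ht, rfl⟩ | ⟨t, ht, rfl⟩
        · exact ⟨t, ht.1, rfl, rfl⟩
        · exact ⟨t, ht.1, rfl, rfl⟩
      | read_body h => exact .inr h
    · rintro (⟨t, ht, rfl, rfl⟩ | h)
      · refine .read_self ?_
        by_cases hU : t ∈ U
        · exact .inr ⟨t, ⟨ht, hU⟩, rfl⟩
        · exact .inl ⟨t, ⟨ht, hU⟩, rfl⟩
      · exact .read_body h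

theorem underline_readSet (U V : Set T) :
    (readSet nm U V).underline = readSet nm Set.univ V := by
  simp [ReadSet.underline, readSet, ← Set.image_union]

theorem timeStep_withReads_iff {U V : Set T} {P : Term B} {X : Set B} {Q : Term B} :
    TimeStep (withReads nm U V P) X Q ↔
      (∀ t ∈ V, t ∈ U → nm t ∉ X) ∧
        ∃ P', TimeStep P X P' ∧ Q = withReads nm Set.univ V P' := by
  unfold withReads
  split_ifs with hV
  · simp [hV]
  · constructor
    · intro h
      cases h with
      | read h hR =>
        refine ⟨fun t ht hU hX => ?_, _, h, by rw [underline_readSet]⟩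
        exact Set.eq_empty_iff_forall_notMem.1 hR (some (nm t))
          ⟨⟨t, ⟨ht, hU⟩, rfl⟩, .inl ⟨_, hX, rfl⟩⟩
    · rintro ⟨h, P', hP, rfl⟩
      rw [← underline_readSet nm U]
      refine .read hP (Set.eq_empty_iff_forall_notMem.2 ?_)
      rintro _ ⟨⟨t, ht, rfl⟩, ht'⟩
      exact h t ht.1 ht.2 (by simpa using ht')

end Prefixes

/-! ### Transitions of parallel compositions of components -/

section Compose

variable (N : ReadNet B S T) (nm : T ↪ B)

/-- The parallel composition of components for the places in a list and of a further component,
synchronising each time over all common transitions. -/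
def parAll (C : S → Term B) (E : Term B) : List S → Term B
  | [] => E
  | s :: l => .par (nm '' (N.adjacent s ∩ ⋃ s' ∈ l, N.adjacent s')) (C s) (parAll C E l)

variable {N nm} {C D : S → Term B} {E E' : Term B}

theorem parAll_congr {l : List S} (h : ∀ s ∈ l, C s = D s) :
    N.parAll nm C E l = N.parAll nm D E l := by
  induction l with
  | nil => rfl
  | cons s l ih =>
    simp only [List.mem_cons, forall_eq_or_imp] at h
    simp only [parAll, h.1, ih h.2]

theorem step_parAll_of {l : List S} {t : T}
    (hadj : ∀ s ∈ l, t ∈ N.adjacent s → Step (C s) (some (nm t)) (D s))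
    (hnadj : ∀ s ∈ l, t ∉ N.adjacent s → D s = C s)
    (h : (∃ s ∈ l, t ∈ N.adjacent s) ∨ Step E (some (nm t)) E) :
    Step (N.parAll nm C E l) (some (nm t)) (N.parAll nm D E l) := by
  induction l with
  | nil => simpa [parAll] using h
  | cons s l ih =>
    simp only [List.mem_cons, forall_eq_or_imp, exists_eq_or_imp] at hadj hnadj h
    simp only [parAll]
    by_cases hs : t ∈ N.adjacent s
    · by_cases hl : ∃ s ∈ l, t ∈ N.adjacent s
      · refine .par_sync ?_ (hadj.1 hs) (ih hadj.2 hnadj.2 (.inl hl))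
        exact ⟨_, ⟨t, ⟨hs, by simpa using hl⟩, rfl⟩, rfl⟩
      · rw [parAll_congr (D := C) fun s hs => hnadj.2 s hs fun h => hl ⟨s, hs, h⟩]
        refine .par_left ?_ (hadj.1 hs)
        simpa using fun _ => by simpa using hl
    · rw [hnadj.1 hs]
      refine .par_right ?_ (ih hadj.2 hnadj.2 (h.imp_left fun h => h.resolve_left hs))
      simp [hs]

/-- Synchronisation over all common names forces every adjacent component to take part. The final
disjunction strengthens the induction: if the tail moves alone, it shows that the head is not
adjacent to `t`. -/
theorem exists_of_step_parAll {l : List S} (hl : l.Nodup) {α : Act B} {Q : Term B}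
    (hC : ∀ s α Q, Step (C s) α Q → ∃ t ∈ N.adjacent s, α = some (nm t))
    (hE : ∀ α Q, Step E α Q → Q = E ∧ ∃ t, (∀ s, t ∉ N.adjacent s) ∧ α = some (nm t))
    (h : Step (N.parAll nm C E l) α Q) :
    ∃ t D, α = some (nm t) ∧ Q = N.parAll nm D E l ∧
      (∀ s ∈ l, t ∈ N.adjacent s → Step (C s) (some (nm t)) (D s)) ∧
      (∀ s ∈ l, t ∉ N.adjacent s → D s = C s) ∧
      ((∃ s ∈ l, t ∈ N.adjacent s) ∨ ∀ s, t ∉ N.adjacent s) := by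
  classical
  induction l generalizing Q with
  | nil =>
    obtain ⟨rfl, t, ht, rfl⟩ := hE _ _ h
    exact ⟨t, C, rfl, rfl, by simp, by simp, .inr ht⟩
  | cons s l ih =>
    obtain ⟨hsl, hl⟩ := List.nodup_cons.1 hl
    have hne : ∀ s' ∈ l, s' ≠ s := fun s' hs' h => hsl (h ▸ hs')
    -- As the list has no duplicates, redefining the component at its head leaves the tail
    -- unchanged.
    have key : ∀ (t : T) (D : S → Term B) (P : Term B),
        (∀ s' ∈ l, Function.update D s P s' = D s') := fun t D P s' hs' =>
      Function.update_of_ne (hne s' hs') _ _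
    simp only [parAll, List.mem_cons, forall_eq_or_imp, exists_eq_or_imp] at h ⊢
    cases h with
    | @par_left _ _ _ _ P hα h =>
      obtain ⟨t, ht, rfl⟩ := hC _ _ _ h
      have hnl : ∀ s' ∈ l, t ∉ N.adjacent s' := by simpa [ht] using hα
      refine ⟨t, Function.update C s P, rfl, ?_, ⟨fun _ => by simpa using h, ?_⟩,
        ⟨fun h => absurd ht h, fun s' hs' _ => key t C P s' hs'⟩, .inl (.inl ht)⟩
      · rw [Function.update_self, parAll_congr (key t C P)]
      · exact fun s' hs' h => absurd h (hnl s' hs')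
    | par_right hα h =>
      obtain ⟨t, D, rfl, rfl, h₁, h₂, h₃⟩ := ih hl h
      have hs : t ∉ N.adjacent s := by
        rcases h₃ with h₃ | h₃
        · simp only [Set.mem_image, Option.some.injEq, exists_eq_right, Set.mem_inter_iff,
            EmbeddingLike.apply_eq_iff_eq, Set.mem_iUnion, exists_prop, not_and] at hα
          exact fun h => hα h h₃
        · exact h₃ s
      refine ⟨t, Function.update D s (C s), rfl, ?_, ⟨fun h => absurd h hs, ?_⟩,
        ⟨fun _ => by simp, ?_⟩, h₃.imp_left .inr⟩
      · rw [Function.update_self, parAll_congr (key t D (C s))]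
      · exact fun s' hs' h => by rw [key t D _ s' hs']; exact h₁ s' hs' h
      · exact fun s' hs' h => by rw [key t D _ s' hs']; exact h₂ s' hs' h
    | @par_sync _ _ _ _ P _ hα h h' =>
      obtain ⟨t, D, rfl, rfl, h₁, h₂, h₃⟩ := ih hl h'
      have hs : t ∈ N.adjacent s := by
        obtain ⟨t', ht', h'⟩ := hC _ _ _ h
        rwa [nm.injective (Option.some.inj h')]
      refine ⟨t, Function.update D s P, rfl, ?_, ⟨fun _ => by simpa using h, ?_⟩,
        ⟨fun h => absurd hs h, ?_⟩, .inl (.inl hs)⟩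
      · rw [Function.update_self, parAll_congr (key t D P)]
      · exact fun s' hs' h => by rw [key t D _ s' hs']; exact h₁ s' hs' h
      · exact fun s' hs' h => by rw [key t D _ s' hs']; exact h₂ s' hs' h

/-- One refusing partner suffices to refuse a synchronised name, so a transition obstructs the time
step only if it lies in `K s` for each adjacent `s` of the list. Transitions adjacent to no place of
the list obstruct only through `K₀`. -/
theorem timeStep_parAll_iff {K : S → Set T} {K₀ : Set T} (l : List S)
    (hK : ∀ s, K s ⊆ N.adjacent s) (hK₀ : ∀ t ∈ K₀, ∀ s, t ∉ N.adjacent s)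
    (hC : ∀ s X Q, TimeStep (C s) X Q ↔ (∀ t ∈ K s, nm t ∉ X) ∧ Q = D s)
    (hE : ∀ X Q, TimeStep E X Q ↔ (∀ t ∈ K₀, nm t ∉ X) ∧ Q = E') {X : Set B} {Q : Term B} :
    TimeStep (N.parAll nm C E l) X Q ↔
      (∀ t, (∀ s ∈ l, t ∈ N.adjacent s → t ∈ K s) →
        ((∃ s ∈ l, t ∈ N.adjacent s) ∨ t ∈ K₀) → nm t ∉ X) ∧ Q = N.parAll nm D E' l := by
  induction l generalizing X Q with
  | nil => simp [parAll, hE]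
  | cons s l ih =>
    simp only [parAll, List.mem_cons, forall_eq_or_imp, exists_eq_or_imp]
    constructor
    · intro h
      cases h with
      | par h₁ h₂ hX =>
        obtain ⟨hs₁, rfl⟩ := (hC _ _ _).1 h₁
        obtain ⟨hl₂, rfl⟩ := ih.1 h₂
        refine ⟨fun t ht ht' htX => ?_, rfl⟩
        rcases hX htX with ⟨⟨t', ⟨hs, hl⟩, htt⟩, hX⟩ | ⟨⟨hX₁, hX₂⟩, hA⟩
        · obtain rfl := nm.injective htt
          simp only [Set.mem_iUnion, exists_prop] at hl
          rcases hX with hX | hX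
          · exact hs₁ _ (ht.1 hs) hX
          · exact hl₂ _ ht.2 (.inl hl) hX
        · by_cases hs : t ∈ N.adjacent s
          · exact hs₁ _ (ht.1 hs) hX₁
          · exact hl₂ _ ht.2 (ht'.imp_left fun h => h.resolve_left hs) hX₂
    · rintro ⟨h, rfl⟩
      -- Each side is given the largest refusal set that it permits.
      refine .par (X₁ := (nm '' K s)ᶜ) (X₂ := (nm '' {t | (∀ s ∈ l, t ∈ N.adjacent s → t ∈ K s) ∧
        ((∃ s ∈ l, t ∈ N.adjacent s) ∨ t ∈ K₀)})ᶜ) ((hC _ _ _).2 ⟨?_, rfl⟩)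
        (ih.2 ⟨?_, rfl⟩) ?_
      · exact fun t ht h => h ⟨t, ht, rfl⟩
      · exact fun t ht ht' h => h ⟨t, ⟨ht, ht'⟩, rfl⟩
      · intro a ha
        by_cases hA : a ∈ nm '' (N.adjacent s ∩ ⋃ s' ∈ l, N.adjacent s')
        · refine .inl ⟨hA, ?_⟩
          rw [← Set.compl_inter]
          rintro ⟨⟨t, ht, rfl⟩, t', ht', htt⟩
          obtain rfl := nm.injective htt
          exact h _ ⟨fun _ => ht, ht'.1⟩ (.inl (.inl (hK s ht))) ha
        · refine .inr ⟨⟨?_, ?_⟩, hA⟩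
          · rintro ⟨t, ht, rfl⟩
            refine h t ⟨fun _ => ht, fun s' hs' h' => ?_⟩ (.inl (.inl (hK s ht))) ha
            exact absurd ⟨t, ⟨hK s ht, by simpa using ⟨s', hs', h'⟩⟩, rfl⟩ hA
          · rintro ⟨t, ⟨ht, ht'⟩, rfl⟩
            refine h t ⟨fun hs => ?_, ht⟩ (ht'.imp_left .inr) ha
            rcases ht' with ht' | ht'
            · exact absurd ⟨t, ⟨hs, by simpa using ht'⟩, rfl⟩ hA
            · exact absurd hs (hK₀ t ht' s)

theorem isProc_parAll {C : S → Term B} {E : Term B} (hC : ∀ s, (C s).IsProc) (hE : E.IsProc)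
    (l : List S) : (N.parAll nm C E l).IsProc := by
  induction l with
  | nil => exact hE
  | cons s l ih => exact ⟨⟨(hC s).1, ih.1⟩, fun x h => h.elim ((hC s).2 x) (ih.2 x)⟩

theorem proper_parAll {C : S → Term B} {E : Term B} (hC : ∀ s, (C s).Proper) (hE : E.Proper)
    (l : List S) : (N.parAll nm C E l).Proper := by
  induction l with
  | nil => exact hE
  | cons s l ih => exact ⟨⟨(hC s).1, ih.1⟩, (hC s).2, ih.2⟩

end Compose

/-! ### Place processes -/

section Places

variable (N : ReadNet B S T)

/-- The transitions that the process of the place `s` carrying `m` tokens offers. -/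
def offers (s : S) (m : ℕ) : Set T :=
  {t | (m = 0 ∧ t ∈ N.fillers s) ∨ (m ≠ 0 ∧ (t ∈ N.readers s ∨ t ∈ N.takers s))}

theorem offers_subset_adjacent (s : S) (m : ℕ) : N.offers s m ⊆ N.adjacent s := by
  rintro t (⟨-, h⟩ | ⟨-, h | h⟩)
  · exact .inr h.1
  · exact .inl (.inr h.1)
  · exact .inl (.inl h)

variable [Fintype T] (nm : T ↪ B)

/-- The process of the place `s` carrying `m` tokens, with the recursion unfolded once, where the
transitions in `W` are urgent. -/
noncomputable def placeTerm (s : S) (m : ℕ) (W : Set T) : Term B :=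
  open Classical in
  if m = 0 then choice nm W (N.fillers s) fun _ => N.markedProc nm s
  else withReads nm W (N.readers s) (choice nm W (N.takers s) fun t =>
    if s ∈ N.post t then N.markedProc nm s else N.emptyProc nm s)

/-- `C` is a process of the place `s` carrying `m` tokens, where the offered transitions in `W`
are urgent. -/
def Represents (s : S) (m : ℕ) (W : Set T) (C : Term B) : Prop :=
  C = N.placeTerm nm s m W ∨ m ≠ 0 ∧ W = ∅ ∧ C = N.markedProc nm s

variable {N nm}

theorem subst_markedProc_body (s : S) {m : ℕ} (hm : m ≠ 0) :
    (open Classical in subst 0 (N.markedProc nm s)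
      (withReads nm ∅ (N.readers s) (choice nm ∅ (N.takers s) fun t =>
        if s ∈ N.post t then .var 0 else choice nm ∅ (N.fillers s) fun _ => .var 0))) =
      N.placeTerm nm s m ∅ := by
  rw [placeTerm, if_neg hm, subst_withReads, subst_choice]
  congr 2
  funext t
  split_ifs
  · simp [subst]
  · simp [subst_choice, subst, emptyProc]

theorem step_markedProc_iff {s : S} {m : ℕ} (hm : m ≠ 0) {α : Act B} {Q : Term B} :
    Step (N.markedProc nm s) α Q ↔ Step (N.placeTerm nm s m ∅) α Q := by
  rw [← subst_markedProc_body s hm]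
  constructor
  · intro h
    unfold markedProc at h
    cases h with
    | recur h => exact h
  · exact fun h => .recur h

theorem timeStep_markedProc_iff {s : S} {m : ℕ} (hm : m ≠ 0) {X : Set B} {Q : Term B} :
    TimeStep (N.markedProc nm s) X Q ↔ TimeStep (N.placeTerm nm s m ∅) X Q := by
  rw [← subst_markedProc_body s hm]
  constructor
  · intro h
    unfold markedProc at h
    cases h with
    | recur h => exact h
  · exact fun h => .recur h

theorem Represents.step_iff {s : S} {m : ℕ} {W : Set T} {C : Term B}
    (h : N.Represents nm s m W C) {α : Act B} {Q : Term B} :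
    Step C α Q ↔ Step (N.placeTerm nm s m W) α Q := by
  rcases h with rfl | ⟨hm, rfl, rfl⟩
  · rfl
  · exact step_markedProc_iff hm

theorem Represents.timeStep_iff {s : S} {m : ℕ} {W : Set T} {C : Term B}
    (h : N.Represents nm s m W C) {X : Set B} {Q : Term B} :
    TimeStep C X Q ↔ (∀ t ∈ N.offers s m ∩ W, nm t ∉ X) ∧
      Q = N.placeTerm nm s m Set.univ := by
  have hC : TimeStep C X Q ↔ TimeStep (N.placeTerm nm s m W) X Q := by
    rcases h with rfl | ⟨hm, rfl, rfl⟩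
    · rfl
    · exact timeStep_markedProc_iff hm
  rw [hC]
  unfold placeTerm offers
  split_ifs with hm
  · simp [timeStep_choice_iff, hm]
  · simp only [timeStep_withReads_iff, timeStep_choice_iff, hm, false_and, false_or, not_false_iff,
      true_and, Set.mem_inter_iff, Set.mem_ofPred_eq, ne_eq, and_imp]
    constructor
    · rintro ⟨h₁, _, ⟨h₂, rfl⟩, rfl⟩
      exact ⟨fun t ht hW => ht.elim (h₁ t · hW) (h₂ t · hW), rfl⟩
    · rintro ⟨h, rfl⟩
      exact ⟨fun t ht => h t (.inl ht), _, ⟨fun t ht => h t (.inr ht), rfl⟩, rfl⟩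

theorem Represents.exists_step {s : S} {m : ℕ} {W : Set T} {C : Term B}
    (h : N.Represents nm s m W C) {t : T} (ht : t ∈ N.offers s m) :
    ∃ Q, Step C (some (nm t)) Q := by
  simp only [h.step_iff]
  unfold placeTerm
  rcases ht with ⟨rfl, ht⟩ | ⟨hm, ht | ht⟩
  · exact ⟨_, by rw [if_pos rfl]; exact (step_choice_iff nm).2 ⟨t, ht, rfl, rfl⟩⟩
  · exact ⟨_, by rw [if_neg hm]; exact (step_withReads_iff nm).2 (.inl ⟨t, ht, rfl, rfl⟩)⟩
  · exact ⟨_, by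
      rw [if_neg hm]
      exact (step_withReads_iff nm).2 (.inr ((step_choice_iff nm).2 ⟨t, ht, rfl, rfl⟩))⟩

-- Reading leaves the component untouched, so `W` survives; any other move leads to a fresh
-- component without urgent actions.
open Classical in
theorem Represents.step {s : S} {m : ℕ} {W : Set T} {C : Term B}
    (h : N.Represents nm s m W C) (hm₁ : m ≤ 1) {α : Act B} {Q : Term B} (hQ : Step C α Q) :
    ∃ t ∈ N.offers s m, α = some (nm t) ∧
      N.Represents nm s (m - (N.pre t).indicator 1 s + (N.post t).indicator 1 s)
        (if t ∈ N.readers s then W else ∅) Q := by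
  rw [h.step_iff] at hQ
  have hQ' := hQ
  unfold placeTerm at hQ
  split_ifs at hQ with hm
  · obtain ⟨t, ht, rfl, rfl⟩ := (step_choice_iff nm).1 hQ
    have hp : s ∉ N.pre t := fun h => ht.2 (.inl h)
    refine ⟨t, .inl ⟨hm, ht⟩, rfl, .inr ⟨?_, if_neg fun h => ht.2 (.inr h.1), rfl⟩⟩
    simp [ht.1]
  · rcases (step_withReads_iff nm).1 hQ with ⟨t, ht, rfl, rfl⟩ | hQ
    · refine ⟨t, .inr ⟨hm, .inl ht⟩, rfl, .inl ?_⟩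
      rw [if_pos ht, placeTerm, if_neg]
      -- A reader may also lie in the net's postset relation to `s`, raising the count above one;
      -- only its being nonzero matters to `placeTerm`.
      simp [ht.2, hm]
    · obtain ⟨t, ht, rfl, rfl⟩ := (step_choice_iff nm).1 hQ
      have ht' : s ∈ N.pre t := ht
      have hr : t ∉ N.readers s := fun h => h.2 ht
      -- Removing a token must empty the place, which is where the bound on `m` is needed.
      have hm1 : m = 1 := by omega
      refine ⟨t, .inr ⟨hm, .inr ht⟩, rfl, ?_⟩
      rw [if_neg hr]
      split_ifs with hp
      · exact .inr ⟨by simp [hp], rfl, rfl⟩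
      · refine .inl ?_
        simp [hp, ht', hm1, placeTerm, emptyProc]

/-! ### Properness -/

theorem isInitial_markedProc (s : S) : (N.markedProc nm s).IsInitial := by
  have h : ∀ k : T → Term B, (∀ t, IsInitial (k t)) → ∀ V : Set T,
      IsInitial (choice nm ∅ V k) := fun k hk V =>
    choice_induction nm trivial fun t _ Q hQ => ⟨⟨by simp, hk t⟩, hQ⟩
  have hg : ∀ (k : T → Term B) (V : Set T), Guarded 0 (choice nm ∅ V k) := fun k V =>
    choice_induction nm trivial fun t _ Q hQ => ⟨trivial, hQ⟩
  have hk := h (fun t => open Classical in if s ∈ N.post t then .var 0 else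
    choice nm ∅ (N.fillers s) fun _ => .var 0)
    (fun t => by split_ifs; exacts [trivial, h (fun _ => .var 0) (fun _ => trivial) _])
    (N.takers s)
  unfold markedProc withReads
  split_ifs
  · exact ⟨hg _ _, hk⟩
  · exact ⟨hg _ _, by simp [readSet], hk⟩

theorem closed_choice {U V : Set T} {k : T → Term B} (hk : ∀ t, (k t).Closed) :
    (choice nm U V k).Closed := fun x =>
  choice_induction nm (P := fun Q => ¬ FreeIn x Q) (by simp [FreeIn])
    fun t _ Q hQ => by simpa [FreeIn, hQ] using hk t x

theorem closed_markedProc (s : S) : (N.markedProc nm s).Closed := by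
  intro x
  have h : ∀ k : T → Term B, (∀ t, FreeIn x (k t) → x = 0) → ∀ V : Set T,
      FreeIn x (choice nm ∅ V k) → x = 0 := fun k hk V =>
    choice_induction nm (P := fun Q => FreeIn x Q → x = 0) (by simp [FreeIn])
      fun t _ Q hQ h => h.elim (hk t) hQ
  have hv : FreeIn x (.var 0 : Term B) → x = 0 := Eq.symm
  have hk := h (fun t => open Classical in if s ∈ N.post t then .var 0 else
    choice nm ∅ (N.fillers s) fun _ => .var 0)
    (fun t => by split_ifs; exacts [hv, h _ (fun _ => hv) _]) (N.takers s)
  unfold markedProc withReads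
  split_ifs
  · exact fun h' => h'.1 (hk h'.2).symm
  · exact fun h' => h'.1 (hk h'.2).symm

theorem readGuarded_choice (U V : Set T) (k : T → Term B) : ReadGuarded (choice nm U V k) :=
  choice_induction nm trivial fun _ _ _ hQ => ⟨trivial, hQ⟩

theorem proper_choice {U V : Set T} {k : T → Term B} (hk : ∀ t, (k t).Proper) :
    (choice nm U V k).Proper := by
  -- Properness of a sum also requires read-guarded summands, so the induction carries both
  -- properties.
  have := choice_induction nm (P := fun Q => ReadGuarded Q ∧ Q.Proper) (U := U) (V := V)
    (k := k) ⟨trivial, trivial, trivial⟩ fun t _ Q hQ =>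
      ⟨⟨trivial, hQ.1⟩, ⟨⟨trivial, hQ.1⟩, (hk t).1, hQ.2.1⟩, (hk t).2, hQ.2.2⟩
  exact this.2

theorem proper_withReads {U V : Set T} {Q : Term B} (hg : ReadGuarded Q) (hQ : Q.Proper) :
    (withReads nm U V Q).Proper := by
  unfold withReads
  split_ifs
  · exact hQ
  · exact ⟨⟨hg, hQ.1⟩, hQ.2⟩

theorem proper_markedProc (s : S) : (N.markedProc nm s).Proper := by
  have hv : (.var 0 : Term B).Proper := ⟨trivial, trivial⟩
  have hp : Proper (choice nm ∅ (N.takers s) fun t => open Classical in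
      if s ∈ N.post t then .var 0 else choice nm ∅ (N.fillers s) fun _ => .var 0) :=
    proper_choice fun t => by split_ifs; exacts [hv, proper_choice fun _ => hv]
  have h : ∀ k : T → Term B, (∀ t, VarProper 0 (k t)) → ∀ V : Set T,
      Guarded 0 (choice nm ∅ V k) ∧ VarProper 0 (choice nm ∅ V k) := fun k hk V =>
    choice_induction nm (P := fun Q => Guarded 0 Q ∧ VarProper 0 Q) ⟨trivial, trivial⟩
      fun t _ Q hQ => ⟨⟨trivial, hQ.1⟩, ⟨trivial, hQ.1⟩, hk t, hQ.2⟩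
  have hk := h (fun t => open Classical in if s ∈ N.post t then .var 0 else
    choice nm ∅ (N.fillers s) fun _ => .var 0)
    (fun t => by split_ifs; exacts [trivial, (h (fun _ => .var 0) (fun _ => trivial) _).2])
    (N.takers s)
  have hr := proper_withReads (nm := nm) (U := ∅) (V := N.readers s) (readGuarded_choice ..) hp
  -- With readers present the body is not read-guarded, so the other alternative for recursions is
  -- used: the variable occurs only behind action prefixes.
  refine ⟨hr.1, .inr ?_, hr.2⟩
  unfold withReads
  split_ifs
  · exact hk.2
  · exact hk

theorem isProc_choice {U V : Set T} {k : T → Term B} (hi : ∀ t, (k t).IsInitial)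
    (hc : ∀ t, (k t).Closed) : (choice nm U V k).IsProc :=
  ⟨choice_induction nm trivial fun t _ _ hQ => ⟨hi t, hQ⟩, closed_choice hc⟩

theorem isProc_withReads {U V : Set T} {Q : Term B} (hQ : Q.IsProc) :
    (withReads nm U V Q).IsProc := by
  unfold withReads
  split_ifs <;> exact hQ

theorem isInitial_emptyProc (s : S) : (N.emptyProc nm s).IsInitial :=
  choice_induction nm trivial fun _ _ _ hQ => ⟨⟨by simp, isInitial_markedProc s⟩, hQ⟩

theorem isProc_placeTerm (s : S) (m : ℕ) (W : Set T) : (N.placeTerm nm s m W).IsProc := by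
  unfold placeTerm
  split_ifs
  · exact isProc_choice (fun _ => isInitial_markedProc s) fun _ => closed_markedProc s
  · refine isProc_withReads (isProc_choice (fun t => ?_) fun t => ?_) <;> split_ifs
    exacts [isInitial_markedProc s, isInitial_emptyProc s, closed_markedProc s,
      closed_choice fun _ => closed_markedProc s]

theorem proper_placeTerm (s : S) (m : ℕ) (W : Set T) : (N.placeTerm nm s m W).Proper := by
  unfold placeTerm
  split_ifs
  · exact proper_choice fun _ => proper_markedProc s
  · refine proper_withReads (readGuarded_choice ..) (proper_choice fun t => ?_)
    split_ifs
    exacts [proper_markedProc s, proper_choice fun _ => proper_markedProc s]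

theorem Represents.mem_adjacent_of_step {s : S} {m : ℕ} {W : Set T} {C : Term B}
    (h : N.Represents nm s m W C) (hm : m ≤ 1) {α : Act B} {Q : Term B} (hQ : Step C α Q) :
    ∃ t ∈ N.adjacent s, α = some (nm t) := by
  obtain ⟨t, ht, hα, -⟩ := h.step hm hQ
  exact ⟨t, N.offers_subset_adjacent s m ht, hα⟩

end Places

/-! ### The bisimulation -/

section Bisimulation

variable (N : ReadNet B S T)

/-- The transitions connected to no place. -/
def isolated : Set T := {t | ∀ s, t ∉ N.adjacent s}

variable {N}

/-! ### Safeness: enabledness and urgency place by place -/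

theorem exists_fires {M : S → ℕ} {t : T} (h : N.Enabled M t) : ∃ M', N.Fires M t M' :=
  ⟨_, h, fun _ => rfl⟩

theorem Reachable.fires {M M' : S → ℕ} {t : T} (hM : N.Reachable M) (h : N.Fires M t M') :
    N.Reachable M' :=
  Relation.ReflTransGen.tail hM ⟨t, h⟩

/-- Otherwise firing `t` would put a second token on `s`. -/
theorem Safe.mem_pre_or_eq_zero (hN : N.Safe) {M : S → ℕ} (hM : N.Reachable M) {t : T}
    (ht : N.Enabled M t) {s : S} (hs : s ∈ N.post t) : s ∈ N.pre t ∨ M s = 0 := by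
  obtain ⟨M', h⟩ := exists_fires ht
  have h₁ := hN M' (hM.fires h) s
  rw [h.2 s] at h₁
  by_contra! hp
  simp [hp.1, hs] at h₁
  exact hp.2 h₁

theorem Safe.enabled_iff (hN : N.Safe) {M : S → ℕ} (hM : N.Reachable M) {t : T} :
    N.Enabled M t ↔ ∀ s, t ∈ N.adjacent s → t ∈ N.offers s (M s) := by
  constructor
  · intro h s hs
    by_cases h0 : M s = 0
    · have hn : s ∉ N.pre t ∪ N.rd t := fun hs' => by have := h s hs'; omega
      exact .inl ⟨h0, hs.resolve_left hn, hn⟩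
    · refine .inr ⟨h0, ?_⟩
      by_cases hp : s ∈ N.pre t
      · exact .inr hp
      · rcases hs with (hs | hs) | hs
        · exact .inr hs
        · exact .inl ⟨hs, hp⟩
        · exact absurd (hN.mem_pre_or_eq_zero hM h hs) (by tauto)
  · intro h s hs
    rcases h s (.inl hs) with h | h
    · exact absurd hs h.2.2
    · exact Nat.one_le_iff_ne_zero.2 h.1

open Classical in
/-- The urgent transitions after firing `t`, when urgency is recorded place by place. -/
theorem Safe.urgent_fires (hN : N.Safe) {M M' : S → ℕ} (hM : N.Reachable M) {t : T}
    (h : N.Fires M t M') (W : S → Set T) (W₀ : Set T) :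
    {u | N.Enabled M u ∧ (∀ s, u ∈ N.adjacent s → u ∈ W s) ∧ (u ∈ N.isolated → u ∈ W₀)} \
        {u | (N.pre t ∩ (N.pre u ∪ N.rd u)).Nonempty} =
      {u | N.Enabled M' u ∧
        (∀ s, u ∈ N.adjacent s → u ∈ if t ∈ N.adjacent s ∧ t ∉ N.readers s then ∅ else W s) ∧
        (u ∈ N.isolated → u ∈ W₀)} := by
  have hM' := hM.fires h
  ext u
  simp only [Set.mem_sdiff, Set.mem_ofPred_eq]
  constructor
  · rintro ⟨⟨hu, hW, hW₀⟩, hd⟩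
    have hnp : ∀ s ∈ N.pre u ∪ N.rd u, s ∉ N.pre t := fun s hs hp => hd ⟨s, hp, hs⟩
    have hu' : N.Enabled M' u := by
      intro s hs
      have := hu s hs
      rw [h.2 s]
      simp only [hnp s hs, not_false_eq_true, Set.indicator_of_notMem]
      omega
    refine ⟨hu', fun s hs => ?_, hW₀⟩
    split_ifs with ht
    · exfalso
      -- If `t` takes the token of `s`, then `u` does not need it and could only fill `s`, which is
      -- marked before the firing. If `t` fills `s`, then `u`, enabled while `s` was empty, could
      -- again only fill `s`, which is marked afterwards. Both contradict safeness.
      by_cases hp : s ∈ N.pre t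
      · have hn : s ∉ N.pre u ∪ N.rd u := fun h => hnp s h hp
        have h0 := hN.mem_pre_or_eq_zero hM hu (hs.resolve_left hn)
        have := h.1 s (.inl hp)
        rcases h0 with h0 | h0
        · exact hn (.inl h0)
        · omega
      · have hr : s ∉ N.rd t := fun hr => ht.2 ⟨hr, hp⟩
        have hpo : s ∈ N.post t := ht.1.resolve_left (by rintro (h | h) <;> contradiction)
        have h0 := (hN.mem_pre_or_eq_zero hM h.1 hpo).resolve_left hp
        have hn : s ∉ N.pre u ∪ N.rd u := fun h => by have := hu s h; omega
        have h1 := (hN.mem_pre_or_eq_zero hM' hu' (hs.resolve_left hn)).resolve_left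
          fun h => hn (.inl h)
        rw [h.2 s] at h1
        simp [hpo] at h1
    · exact hW s hs
  · rintro ⟨hu', hW, hW₀⟩
    -- At every place shared by `t` and `u`, `t` is merely a reader; hence the tokens that `u` needs
    -- were already there.
    have hnt : ∀ s, u ∈ N.adjacent s → ¬ (t ∈ N.adjacent s ∧ t ∉ N.readers s) := by
      intro s hs ht
      have := hW s hs
      rw [if_pos ht] at this
      exact this
    have hnp : ∀ s ∈ N.pre u ∪ N.rd u, s ∉ N.pre t := fun s hs hp =>
      hnt s (.inl hs) ⟨.inl (.inl hp), fun h => h.2 hp⟩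
    refine ⟨⟨fun s hs => ?_, fun s hs => ?_, hW₀⟩, ?_⟩
    · by_cases hp : s ∈ N.post t
      · by_contra h0
        refine hnt s (.inl hs) ⟨.inr hp, fun hr => h0 (h.1 s (.inr hr.1))⟩
      · have := hu' s hs
        rw [h.2 s] at this
        simpa [hp, hnp s hs] using this
    · have := hW s hs
      rwa [if_neg (hnt s hs)] at this
    · rintro ⟨s, hp, hs⟩
      exact hnp s hs hp

/-! ### The correspondence between net states and processes -/

variable [Fintype T] (N) (nm : T ↪ B)

theorem compose_eq_parAll (U : Set T) (l : List S) :
    N.compose nm U l = N.parAll nm (fun s => N.placeTerm nm s (N.init s) U)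
      (withReads nm U N.isolated .nil) l := by
  induction l with
  | nil => rfl
  | cons s l ih => rw [compose, ih]; rfl

theorem relabelling_apply (t : T) : (N.relabelling nm).toFun (some (nm t)) = N.label t := by
  have h : ∃ t', some (nm t') = some (nm t) := ⟨t, rfl⟩
  have h' : h.choose = t := nm.injective (Option.some.inj h.choose_spec)
  simp only [relabelling]
  rw [dif_pos h, h']

variable {N nm} in
theorem step_isolated_iff {W₀ : Set T} {α : Act B} {Q : Term B} :
    Step (withReads nm W₀ N.isolated .nil) α Q ↔
      Q = withReads nm W₀ N.isolated .nil ∧ ∃ t, (∀ s, t ∉ N.adjacent s) ∧ α = some (nm t) := by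
  rw [step_withReads_iff]
  constructor
  · rintro (⟨t, ht, rfl, rfl⟩ | ⟨⟨⟩⟩)
    exact ⟨rfl, t, ht, rfl⟩
  · rintro ⟨rfl, t, ht, rfl⟩
    exact .inl ⟨t, ht, rfl, rfl⟩

variable [Fintype S]

/-- The states of the net and the processes that consist of corresponding place processes. -/
def Corresponds (D : ID S T) (Q : Term B) : Prop :=
  N.Reachable D.marking ∧ ∃ (W : S → Set T) (W₀ : Set T) (C : S → Term B),
    (∀ s, N.Represents nm s (D.marking s) (W s) (C s)) ∧
    Q = .rel (N.parAll nm C (withReads nm W₀ N.isolated .nil) Finset.univ.toList)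
      (N.relabelling nm) ∧
    D.urgent = {u | N.Enabled D.marking u ∧ (∀ s, u ∈ N.adjacent s → u ∈ W s) ∧
      (u ∈ N.isolated → u ∈ W₀)}

variable {N nm}

theorem Safe.corresponds_fires (hN : N.Safe) {D D' : ID S T} (hD : N.Reachable D.marking)
    {W : S → Set T} {W₀ : Set T} {C C' : S → Term B}
    (hC : ∀ s, N.Represents nm s (D.marking s) (W s) (C s))
    (hU : D.urgent = {u | N.Enabled D.marking u ∧ (∀ s, u ∈ N.adjacent s → u ∈ W s) ∧
      (u ∈ N.isolated → u ∈ W₀)})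
    {t : T} (h : N.FiresID D t D')
    (hadj : ∀ s, t ∈ N.adjacent s → Step (C s) (some (nm t)) (C' s))
    (hnadj : ∀ s, t ∉ N.adjacent s → C' s = C s) :
    N.Corresponds nm D' (.rel (N.parAll nm C' (withReads nm W₀ N.isolated .nil)
      Finset.univ.toList) (N.relabelling nm)) := by
  classical
  refine ⟨hD.fires h.1, fun s => if t ∈ N.adjacent s ∧ t ∉ N.readers s then ∅ else W s, W₀, C',
    fun s => ?_, rfl, ?_⟩
  · rw [h.1.2 s]
    by_cases hs : t ∈ N.adjacent s
    · obtain ⟨t', -, htt, hR⟩ := (hC s).step (hN _ hD s) (hadj s hs)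
      obtain rfl := nm.injective (Option.some.inj htt)
      by_cases hr : t ∈ N.readers s <;> simpa [hs, hr] using hR
    · have h₁ : s ∉ N.pre t := fun h => hs (.inl (.inl h))
      have h₂ : s ∉ N.post t := fun h => hs (.inr h)
      simpa [hs, hnadj s hs, h₁, h₂] using hC s
  · rw [h.2, hU]
    exact hN.urgent_fires hD h.1 W W₀

/-- The names obstructing a time step are those offered urgently by all adjacent components, and by
`Safe.enabled_iff` these name exactly the urgent transitions of the net. The relabelling rule pulls
the refusal set back to names and adds those with internal label. -/
theorem Safe.timeStep_iff (hN : N.Safe) {D : ID S T} (hD : N.Reachable D.marking)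
    {W : S → Set T} {W₀ : Set T} {C : S → Term B}
    (hC : ∀ s, N.Represents nm s (D.marking s) (W s) (C s))
    (hU : D.urgent = {u | N.Enabled D.marking u ∧ (∀ s, u ∈ N.adjacent s → u ∈ W s) ∧
      (u ∈ N.isolated → u ∈ W₀)}) {X : Set B} {Q : Term B} :
    TimeStep (.rel (N.parAll nm C (withReads nm W₀ N.isolated .nil) Finset.univ.toList)
        (N.relabelling nm)) X Q ↔
      (∀ t ∈ D.urgent, N.label t ∉ some '' X ∪ {none}) ∧
        Q = .rel (N.parAll nm (fun s => N.placeTerm nm s (D.marking s) Set.univ)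
          (withReads nm Set.univ N.isolated .nil) Finset.univ.toList) (N.relabelling nm) := by
  have key := fun (X : Set B) (Q : Term B) =>
    timeStep_parAll_iff (N := N) (nm := nm) (C := C) (E := withReads nm W₀ N.isolated .nil)
      (D := fun s => N.placeTerm nm s (D.marking s) Set.univ)
      (E' := withReads nm Set.univ N.isolated .nil)
      (K := fun s => N.offers s (D.marking s) ∩ W s) (K₀ := N.isolated ∩ W₀)
      Finset.univ.toList (fun s t ht => N.offers_subset_adjacent s _ ht.1) (fun t ht => ht.1)
      (fun s X Q => (hC s).timeStep_iff) (fun X Q => by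
        rw [timeStep_withReads_iff]
        constructor
        · rintro ⟨h, _, ⟨⟩, rfl⟩
          exact ⟨fun t ht => h t ht.1 ht.2, rfl⟩
        · rintro ⟨h, rfl⟩
          exact ⟨fun t h₁ h₂ => h t ⟨h₁, h₂⟩, _, .nil, rfl⟩) (X := X) (Q := Q)
  have hmem : ∀ t, t ∈ D.urgent ↔
      (∀ s, t ∈ N.adjacent s → t ∈ N.offers s (D.marking s) ∩ W s) ∧
        ((∃ s, t ∈ N.adjacent s) ∨ t ∈ N.isolated ∩ W₀) := by
    intro t
    rw [hU, Set.mem_ofPred_eq, hN.enabled_iff hD]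
    have : t ∈ N.isolated ↔ ¬ ∃ s, t ∈ N.adjacent s := by simp [isolated]
    simp only [Set.mem_inter_iff, this]
    constructor
    · rintro ⟨h₁, h₂, h₃⟩
      exact ⟨fun s hs => ⟨h₁ s hs, h₂ s hs⟩, by tauto⟩
    · rintro ⟨h₁, h₂⟩
      exact ⟨fun s hs => (h₁ s hs).1, fun s hs => (h₁ s hs).2, by tauto⟩
  simp only [Finset.mem_toList, Finset.mem_univ, true_and, true_imp_iff] at key
  constructor
  · intro h
    cases h with
    | rel h =>
      obtain ⟨hX, rfl⟩ := (key _ _).1 h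
      refine ⟨fun t ht => ?_, rfl⟩
      have := hX t ((hmem t).1 ht).1 ((hmem t).1 ht).2
      rwa [Set.mem_ofPred_eq, relabelling_apply] at this
  · rintro ⟨h, rfl⟩
    refine .rel ((key _ _).2 ⟨fun t ht ht' => ?_, rfl⟩)
    rw [Set.mem_ofPred_eq, relabelling_apply]
    exact h t ((hmem t).2 ⟨ht, ht'⟩)

theorem Safe.isTimedBisimulation (hN : N.Safe) :
    IsTimedBisimulation N.lts (Term.lts B) (N.Corresponds nm) := by
  rintro D _ ⟨hD, W, W₀, C, hC, rfl, hU⟩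
  have hafter : ∀ D' X, N.TimeStepID D X D' → N.Corresponds nm D'
      (.rel (N.parAll nm (fun s => N.placeTerm nm s (D.marking s) Set.univ)
        (withReads nm Set.univ N.isolated .nil) Finset.univ.toList) (N.relabelling nm)) := by
    rintro ⟨M', U'⟩ X ⟨-, rfl, rfl⟩
    exact ⟨hD, fun _ => Set.univ, Set.univ, _, fun s => .inl rfl, rfl, by simp⟩
  refine ⟨?_, ?_, ?_, ?_⟩
  · rintro α D' ⟨t, rfl, h⟩
    have hoff := (hN.enabled_iff hD).1 h.1.1
    have : ∀ s, ∃ Q, (t ∈ N.adjacent s → Step (C s) (some (nm t)) Q) ∧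
        (t ∉ N.adjacent s → Q = C s) := by
      intro s
      by_cases hs : t ∈ N.adjacent s
      · obtain ⟨Q, hQ⟩ := (hC s).exists_step (hoff s hs)
        exact ⟨Q, fun _ => hQ, fun h => absurd hs h⟩
      · exact ⟨C s, fun h => absurd h hs, fun _ => rfl⟩
    choose C' hadj hnadj using this
    refine ⟨_, ?_, hN.corresponds_fires hD hC hU h hadj hnadj⟩
    rw [← relabelling_apply N nm t]
    refine Step.rel (step_parAll_of (fun s _ => hadj s) (fun s _ => hnadj s) ?_)
    by_cases hi : ∃ s, t ∈ N.adjacent s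
    · exact .inl (by simpa using hi)
    · exact .inr (step_isolated_iff.2 ⟨rfl, t, by simpa using hi, rfl⟩)
  · intro X D' h
    exact ⟨_, (hN.timeStep_iff hD hC hU).2 ⟨h.1, rfl⟩, hafter D' X h⟩
  · intro α Q h
    change Step _ _ _ at h
    cases h with
    | rel h =>
      obtain ⟨t, C', rfl, rfl, hadj, hnadj, -⟩ := exists_of_step_parAll (Finset.nodup_toList _)
        (fun s α Q hQ => (hC s).mem_adjacent_of_step (hN _ hD s) hQ)
        (fun α Q hQ => step_isolated_iff.1 hQ) h
      simp only [Finset.mem_toList, Finset.mem_univ, true_imp_iff] at hadj hnadj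
      -- Every adjacent component has just performed the name of `t`, hence offered it.
      have hen : N.Enabled D.marking t := (hN.enabled_iff hD).2 fun s hs => by
        obtain ⟨t', ht', htt, -⟩ := (hC s).step (hN _ hD s) (hadj s hs)
        rwa [nm.injective (Option.some.inj htt)]
      obtain ⟨M', hM'⟩ := exists_fires hen
      have hfire : N.FiresID D t ⟨M', _⟩ := ⟨hM', rfl⟩
      exact ⟨_, ⟨t, (relabelling_apply N nm t).symm, hfire⟩,
        hN.corresponds_fires hD hC hU hfire hadj hnadj⟩
  · intro X Q h
    obtain ⟨hX, rfl⟩ := (hN.timeStep_iff hD hC hU).1 h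
    have ht : N.TimeStepID D X ⟨D.marking, {t | N.Enabled D.marking t}⟩ :=
      ⟨hX, rfl, rfl⟩
    exact ⟨_, ht, hafter _ X ht⟩

end Bisimulation

end ReadNet

/-! ### The translation theorem -/

theorem theorem3 {B S T : Type*} [Infinite B] [Fintype S] [Fintype T]
    (N : ReadNet B S T) (hN : N.Safe)
    (U : Set T) (hU : ∀ t ∈ U, N.Enabled N.init t) :
    ∃ Q : Term B, Q.IsProc ∧ Q.Proper ∧
      TimedBisimilar N.lts (Term.lts B) ⟨N.init, U⟩ Q ∧
      ∃ nm : T ↪ B, Q = N.toTerm nm U := by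
  let nm : T ↪ B := (Fintype.equivFin T).toEmbedding.trans
    (Fin.valEmbedding.trans (Infinite.natEmbedding B))
  refine ⟨N.toTerm nm U, ?_, ?_, ⟨_, hN.isTimedBisimulation (nm := nm), ?_⟩, nm, rfl⟩
  · rw [ReadNet.toTerm, ReadNet.compose_eq_parAll]
    exact ReadNet.isProc_parAll (fun s => ReadNet.isProc_placeTerm s _ U)
      (ReadNet.isProc_withReads (Q := .nil) ⟨trivial, fun _ => id⟩) Finset.univ.toList
  · rw [ReadNet.toTerm, ReadNet.compose_eq_parAll]
    exact ReadNet.proper_parAll (fun s => ReadNet.proper_placeTerm s _ U)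
      (ReadNet.proper_withReads (Q := .nil) trivial ⟨trivial, trivial⟩) Finset.univ.toList
  -- Initially every component uses the same set `U`. It is recovered from the invariant because
  -- each transition is adjacent to some place or isolated, and because `U` contains only enabled
  -- transitions.
  · refine ⟨.refl, fun _ => U, U, _, fun s => .inl rfl, ?_, ?_⟩
    · rw [ReadNet.toTerm, ReadNet.compose_eq_parAll]
    · ext t
      exact ⟨fun ht => ⟨hU t ht, fun _ _ => ht, fun _ => ht⟩, fun ht => by
        by_cases hi : ∃ s, t ∈ N.adjacent s
        · exact hi.elim ht.2.1
        · exact ht.2.2 (by simpa [ReadNet.isolated] using hi)⟩
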